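/- Let $\mathcal H$ be a complex Hilbert space and let $P,Q\in\mathcal B(\mathcal H)$ be orthogonal projections. Put $$\mathcal M_{00}=\operatorname{Ran}P\cap\operatorname{Ran}Q,\quad \mathcal M_{01}=\operatorname{Ran}P\cap\operatorname{Ker}Q,\quad \mathcal M_{10}=\operatorname{Ran}Q\cap\operatorname{Ker}P,\quad \mathcal M_{11}=\operatorname{Ker}P\cap\operatorname{Ker}Q,$$ let $\mathcal G$ be the orthogonal complement of $\mathcal M_{00}\oplus\mathcal M_{01}\oplus\mathcal M_{10}\oplus\mathcal M_{11}$ in $\mathcal H$, and put $A=P-Q$, $B=I-P-Q$. Suppose that $\dim\mathcal M_{01}=\dim\mathcal M_{10}$ (Hilbert space dimension). A canonical form of the pair consists of a Hilbert space $\mathcal K$, a unitary operator $\mathbf Y:\mathcal K\oplus\mathcal K\to\mathcal G$ and a positive definite operator $a$ on $\mathcal K$ (that is, $a=a^*$ and $\langle ax,x\rangle>0$ for $x\ne0$), with spectrum in $[0,1]$ and without the eigenvalue $1$, such that $$A|_{\mathcal G}=\mathbf Y\begin{bmatrix}a&0\\0&-a\end{bmatrix}\mathbf Y^*,\qquad B|_{\mathcal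 G}=\mathbf Y\begin{bmatrix}0&\sqrt{I-a^2}\\\sqrt{I-a^2}&0\end{bmatrix}\mathbf Y^*.$$ Then a canonical form exists. Moreover, for every canonical form $(\mathcal K,\mathbf Y,a)$, an operator $U\in\mathcal B(\mathcal H)$ is unitary and satisfies $$Q=UPU^*,\qquad P=UQU^*$$ (equivalently, $U$ is unitary, $UP=QU$ and $UQ=PU$) if and only if, with respect to the decomposition $\mathcal H=\mathcal M_{00}\oplus(\mathcal M_{10}\oplus\mathcal M_{01})\oplus\mathcal M_{11}\oplus\mathcal G$, $$U=U_0\oplus\begin{bmatrix}0&U_{10}\\U_{01}&0\end{bmatrix}\oplus U_1\oplus\mathbf Y\begin{bmatrix}0&v\\v&0\end{bmatrix}\mathbf Y^*$$ for some unitary operators $U_0:\mathcal M_{00}\to\mathcal M_{00}$, $U_{10}:\mathcal M_{01}\to\mathcal M_{10}$, $U_{01}:\mathcal M_{10}\to\mathcal M_{01}$, $U_1:\mathcal M_{11}\to\mathcal M_{11}$ (each onto its target) and some unitary operator $v$ on $\mathcal K$ commuting with $a$. -/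

import Mathlib

open scoped InnerProductSpace

noncomputable section

namespace TwoProjections

/-- The Hilbert space dimension: the cardinality of a Hilbert (orthonormal) basis. All Hilbert bases
of a Hilbert space have the same cardinality and at least one exists, so the infimum is over a
one-element set. -/
def hilbertDim (E : Type*) [NormedAddCommGroup E] [InnerProductSpace ℂ E] : Cardinal :=
  sInf {c : Cardinal | ∃ w : Set E, Nonempty (HilbertBasis w ℂ E) ∧ c = Cardinal.mk w}

variable {H : Type*} [NormedAddCommGroup H] [InnerProductSpace ℂ H]

/-- `M₀₀ = Ran P ∩ Ran Q`. -/
def M00 (P Q : H →L[ℂ] H) : Submodule ℂ H := P.range ⊓ Q.range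

/-- `M₀₁ = Ran P ∩ Ker Q`. -/
def M01 (P Q : H →L[ℂ] H) : Submodule ℂ H := P.range ⊓ Q.ker

/-- `M₁₀ = Ran Q ∩ Ker P`. -/
def M10 (P Q : H →L[ℂ] H) : Submodule ℂ H := Q.range ⊓ P.ker

/-- `M₁₁ = Ker P ∩ Ker Q`. -/
def M11 (P Q : H →L[ℂ] H) : Submodule ℂ H := P.ker ⊓ Q.ker

/-- The generic part: the orthogonal complement of `M₀₀ ⊕ M₀₁ ⊕ M₁₀ ⊕ M₁₁`. -/
def generic (P Q : H →L[ℂ] H) : Submodule ℂ H := (M00 P Q ⊔ M01 P Q ⊔ M10 P Q ⊔ M11 P Q)ᗮ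

theorem hasOrthogonalProjection_inf [CompleteSpace H] {L N : Submodule ℂ H}
    (hL : IsClosed (L : Set H)) (hN : IsClosed (N : Set H)) :
    (L ⊓ N).HasOrthogonalProjection := by
  have h : IsClosed ((L ⊓ N : Submodule ℂ H) : Set H) := hL.inter hN
  have : CompleteSpace (L ⊓ N : Submodule ℂ H) := h.completeSpace_coe
  infer_instance

theorem isClosed_range_of_isStarProjection [CompleteSpace H] {P : H →L[ℂ] H}
    (hP : IsStarProjection P) : IsClosed (P.range : Set H) :=
  ContinuousLinearMap.IsIdempotentElem.isClosed_range hP.isIdempotentElem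

theorem hasOrthogonalProjection_M00 [CompleteSpace H] {P Q : H →L[ℂ] H}
    (hP : IsStarProjection P) (hQ : IsStarProjection Q) : (M00 P Q).HasOrthogonalProjection :=
  hasOrthogonalProjection_inf (isClosed_range_of_isStarProjection hP)
    (isClosed_range_of_isStarProjection hQ)

theorem hasOrthogonalProjection_M01 [CompleteSpace H] {P : H →L[ℂ] H} (Q : H →L[ℂ] H)
    (hP : IsStarProjection P) : (M01 P Q).HasOrthogonalProjection :=
  hasOrthogonalProjection_inf (isClosed_range_of_isStarProjection hP) Q.isClosed_ker

theorem hasOrthogonalProjection_M10 [CompleteSpace H] (P : H →L[ℂ] H) {Q : H →L[ℂ] H}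
    (hQ : IsStarProjection Q) : (M10 P Q).HasOrthogonalProjection :=
  hasOrthogonalProjection_inf (isClosed_range_of_isStarProjection hQ) P.isClosed_ker

theorem hasOrthogonalProjection_M11 [CompleteSpace H] (P Q : H →L[ℂ] H) :
    (M11 P Q).HasOrthogonalProjection :=
  hasOrthogonalProjection_inf P.isClosed_ker Q.isClosed_ker

instance hasOrthogonalProjection_generic [CompleteSpace H] (P Q : H →L[ℂ] H) :
    (generic P Q).HasOrthogonalProjection := by
  unfold generic
  infer_instance

/-- The operator on `H = M₀₀ ⊕ (M₁₀ ⊕ M₀₁) ⊕ M₁₁ ⊕ generic` given by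
`U₀ ⊕ [[0, U₁₀], [U₀₁, 0]] ⊕ U₁ ⊕ T`, where `U₁₀ : M₀₁ → M₁₀` and `U₀₁ : M₁₀ → M₀₁`: the sum of the
compressions of its pieces, each precomposed with the orthogonal projection onto its domain. -/
def directSum [CompleteSpace H] {P Q : H →L[ℂ] H}
    (hP : IsStarProjection P) (hQ : IsStarProjection Q)
    (U₀ : M00 P Q →L[ℂ] M00 P Q) (U₁₀ : M01 P Q →L[ℂ] M10 P Q) (U₀₁ : M10 P Q →L[ℂ] M01 P Q)
    (U₁ : M11 P Q →L[ℂ] M11 P Q) (T : generic P Q →L[ℂ] generic P Q) : H →L[ℂ] H :=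
  haveI := hasOrthogonalProjection_M00 hP hQ
  haveI := hasOrthogonalProjection_M01 Q hP
  haveI := hasOrthogonalProjection_M10 P hQ
  haveI := hasOrthogonalProjection_M11 P Q
  (M00 P Q).subtypeL ∘L U₀ ∘L (M00 P Q).orthogonalProjectionOnto
    + (M10 P Q).subtypeL ∘L U₁₀ ∘L (M01 P Q).orthogonalProjectionOnto
    + (M01 P Q).subtypeL ∘L U₀₁ ∘L (M10 P Q).orthogonalProjectionOnto
    + (M11 P Q).subtypeL ∘L U₁ ∘L (M11 P Q).orthogonalProjectionOnto
    + (generic P Q).subtypeL ∘L T ∘L (generic P Q).orthogonalProjectionOnto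

variable {K : Type*} [NormedAddCommGroup K] [InnerProductSpace ℂ K]

/-- The block operator matrix `[[x₁₁, x₁₂], [x₂₁, x₂₂]]` on the Hilbert space `K ⊕ K`. -/
def block (x₁₁ x₁₂ x₂₁ x₂₂ : K →L[ℂ] K) : WithLp 2 (K × K) →L[ℂ] WithLp 2 (K × K) :=
  let e := WithLp.prodContinuousLinearEquiv 2 ℂ K K
  let p₁ := ContinuousLinearMap.fst ℂ K K
  let p₂ := ContinuousLinearMap.snd ℂ K K
  e.symm.toContinuousLinearMap ∘L
    ((x₁₁ ∘L p₁ + x₁₂ ∘L p₂).prod (x₂₁ ∘L p₁ + x₂₂ ∘L p₂)) ∘L e.toContinuousLinearMap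

/-- The operator `Y X Y*` on the generic part, for a unitary `Y : K ⊕ K → generic` and an operator
`X` on `K ⊕ K`. -/
def conjugate {P Q : H →L[ℂ] H} (Y : WithLp 2 (K × K) ≃ₗᵢ[ℂ] generic P Q)
    (X : WithLp 2 (K × K) →L[ℂ] WithLp 2 (K × K)) : generic P Q →L[ℂ] generic P Q :=
  Y.toContinuousLinearEquiv.toContinuousLinearMap ∘L X ∘L
    Y.symm.toContinuousLinearEquiv.toContinuousLinearMap

/-- `Y` and `a` bring `A = P - Q` and `B = I - P - Q` into the canonical anticommuting form: on the
generic part, `A = Y diag(a, -a) Y*` and `B = Y [[0, √(I - a²)], [√(I - a²), 0]] Y*`, where `Y` is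
unitary and `a` is a positive definite operator with spectrum in `[0, 1]` that does not have `1` as
an eigenvalue. -/
structure IsCanonicalForm [CompleteSpace K] (P Q : H →L[ℂ] H) (a : K →L[ℂ] K)
    (Y : WithLp 2 (K × K) ≃ₗᵢ[ℂ] generic P Q) : Prop where
  selfAdjoint : IsSelfAdjoint a
  posDef : ∀ x : K, x ≠ 0 → 0 < RCLike.re ⟪a x, x⟫_ℂ
  spectrum_subset : spectrum ℝ a ⊆ Set.Icc 0 1
  not_eigenvalue_one : ¬ Module.End.HasEigenvalue (a : K →ₗ[ℂ] K) 1
  eq_A : ∀ x : generic P Q, (P - Q) (x : H) = (conjugate Y (block a 0 0 (-a)) x : H)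
  eq_B : ∀ x : generic P Q, (1 - P - Q) (x : H) =
    (conjugate Y (block 0 (CFC.sqrt (1 - a ^ 2)) (CFC.sqrt (1 - a ^ 2)) 0) x : H)

end TwoProjections

end

/-! On all of `H` the operators `A = P - Q` and `B = 1 - P - Q` satisfy `A² + B² = 1` and `BA =
-AB`, and on the generic part both are injective.

Existence: let `J` and `V` be the signs of `A` and `B` on the generic part. They are anticommuting
symmetries, so `V` swaps the two eigenspaces of `J`. With `K` the `1`-eigenspace of `J`, `Y (x, y) =
x + V y` is unitary, `a` is `A` restricted to `K`, and `|B|` restricted to `K` is the square root of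
`1 - a²` (`exists_sign`, `exists_anticommuting_model`).

Description of `U`: the relations `UP = QU`, `UQ = PU` pass to `U*`, so `U` permutes the four
special subspaces and preserves the generic part. There they say that `U` anticommutes with `A` and
commutes with `B`. In block form, positivity and injectivity of `a` kill the diagonal entries, and
injectivity of `√(1 - a²)` makes the off-diagonal ones equal (`unitary_intertwining_iff`). -/

namespace TwoProjections

open scoped ComplexOrder

/-! ### Positive operators and the sign of a self-adjoint operator -/

section Sign

variable {E : Type*} [NormedAddCommGroup E] [InnerProductSpace ℂ E] [CompleteSpace E]

/-- The inner product equals `‖√T x‖²`, and `T = √T √T`. -/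
theorem apply_eq_zero_of_nonneg {T : E →L[ℂ] E} (hT : 0 ≤ T) {x : E} (hx : ⟪T x, x⟫_ℂ = 0) :
    T x = 0 := by
  have hs : (CFC.sqrt T) * (CFC.sqrt T) = T := CFC.sqrt_mul_sqrt_self T
  have hsa : IsSelfAdjoint (CFC.sqrt T) := .of_nonneg (CFC.sqrt_nonneg T)
  have h1 (y : E) : T y = CFC.sqrt T (CFC.sqrt T y) := by
    conv_lhs => rw [← hs]
    rfl
  have h0 : CFC.sqrt T x = 0 := by
    rw [h1, ← ContinuousLinearMap.adjoint_inner_right, hsa.adjoint_eq, inner_self_eq_zero] at hx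
    exact hx
  rw [h1, h0, map_zero]

theorem re_inner_pos_of_nonneg {T : E →L[ℂ] E} (hT : 0 ≤ T) (hinj : ∀ x, T x = 0 → x = 0)
    {x : E} (hx : x ≠ 0) : 0 < RCLike.re ⟪T x, x⟫_ℂ := by
  have hpos := (ContinuousLinearMap.nonneg_iff_isPositive T).1 hT
  have h := hpos.inner_nonneg_left x
  rcases h.lt_or_eq with h | h
  · exact (RCLike.pos_iff.1 h).1
  · exact absurd (hinj x (apply_eq_zero_of_nonneg hT h.symm)) hx

theorem nonneg_of_re_inner_nonneg {T : E →L[ℂ] E} (hT : IsSelfAdjoint T)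
    (h : ∀ x, 0 ≤ RCLike.re ⟪T x, x⟫_ℂ) : 0 ≤ T :=
  (ContinuousLinearMap.nonneg_iff_isPositive T).2
    (ContinuousLinearMap.isPositive_def.2 ⟨hT.isSymmetric, h⟩)

/-- A self-adjoint injective operator has dense range, so it cancels on the right. -/
theorem mul_right_cancel_of_injective {R M N : E →L[ℂ] E} (hR : IsSelfAdjoint R)
    (hinj : ∀ x, R x = 0 → x = 0) (h : M * R = N * R) : M = N := by
  have h' : R * star M = R * star N := by
    have := congrArg star h
    rwa [star_mul, star_mul, hR.star_eq] at this
  refine star_injective (ContinuousLinearMap.ext fun x ↦ sub_eq_zero.1 (hinj _ ?_))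
  rw [map_sub, sub_eq_zero]
  exact DFunLike.congr_fun h' x

theorem abs_mul_abs_of_isSelfAdjoint {T : E →L[ℂ] E} (hT : IsSelfAdjoint T) :
    CFC.abs T * CFC.abs T = T * T := by
  rw [CFC.abs_mul_abs, hT.star_eq]

theorem abs_injective {T : E →L[ℂ] E} (hT : IsSelfAdjoint T) (hinj : ∀ x, T x = 0 → x = 0)
    (x : E) (hx : CFC.abs T x = 0) : x = 0 := by
  refine hinj _ (hinj _ ?_)
  have := DFunLike.congr_fun (abs_mul_abs_of_isSelfAdjoint hT) x
  simp only [mul_apply_eq_comp, hx, map_zero] at this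
  exact this.symm

/-- `|T|` is a function of `T²`. Hence the square suffices, which also covers operators that
anticommute with `T`. -/
theorem commute_abs {S T : E →L[ℂ] E} (hT : IsSelfAdjoint T) (h : Commute S (T * T)) :
    Commute S (CFC.abs T) := by
  rw [CFC.abs, CFC.sqrt, hT.star_eq]
  exact (h.symm.cfcₙ_nnreal _).symm

/-- The sign of a self-adjoint operator. -/
theorem exists_sign {T : E →L[ℂ] E} (hT : IsSelfAdjoint T) :
    ∃ J : E →L[ℂ] E, IsSelfAdjoint J ∧ J * J = 1 ∧ J * T = CFC.abs T := by
  -- `K` contains the range of `T⁺`, while `T⁺ T⁻ = 0` puts the range of `T⁻` in its complement. The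
  -- reflection `2p - 1` in `K` therefore turns `T⁺ - T⁻` into `T⁺ + T⁻`.
  let K := (T⁺).kerᗮ
  let p : E →L[ℂ] E := K.starProjection
  have hp : IsStarProjection p := isStarProjection_starProjection
  have hsa : IsSelfAdjoint (T⁺) := .of_nonneg (CFC.posPart_nonneg T)
  have h1 : p * T⁺ = T⁺ := by
    ext x
    refine Submodule.starProjection_eq_self_iff.2 ?_
    change _ ∈ (T⁺).kerᗮ
    rw [Submodule.mem_orthogonal]
    intro y hy
    have : (T⁺) y = 0 := hy
    change ⟪y, (T⁺) x⟫_ℂ = 0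
    rw [← ContinuousLinearMap.adjoint_inner_left, hsa.adjoint_eq, this, inner_zero_left]
  have h2 : p * T⁻ = 0 := by
    ext x
    refine (Submodule.starProjection_apply_eq_zero_iff _).2 ?_
    refine Submodule.le_orthogonal_orthogonal _ ?_
    exact DFunLike.congr_fun (CFC.posPart_mul_negPart T) x
  refine ⟨p + p - 1, (hp.isSelfAdjoint.add hp.isSelfAdjoint).sub (.one _), ?_, ?_⟩
  · have : p * p = p := hp.isIdempotentElem
    simp only [mul_sub, sub_mul, mul_add, add_mul, this, mul_one, one_mul]
    abel
  · conv_lhs => rw [← CFC.posPart_sub_negPart T hT]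
    rw [← CFC.posPart_add_negPart T hT]
    simp only [sub_mul, add_mul, mul_sub, h1, h2, one_mul]
    abel

/-- If `S` anticommutes with `T`, it anticommutes with the sign of `T`. -/
theorem anticommute_sign {S T J : E →L[ℂ] E} (hT : IsSelfAdjoint T)
    (hinj : ∀ x, T x = 0 → x = 0) (hJ : J * J = 1) (hJT : J * T = CFC.abs T)
    (h : S * T = -(T * S)) : S * J = -(J * S) := by
  have hT' : J * CFC.abs T = T := by rw [← hJT, ← mul_assoc, hJ, one_mul]
  have hc : Commute S (T * T) := by
    rw [Commute, SemiconjBy, ← mul_assoc, h, neg_mul, mul_assoc, h, mul_neg, neg_neg, mul_assoc]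
  have hc' := (commute_abs hT hc).eq
  -- After multiplication by `|T|` on the right: `S J |T| = S T = -T S = -J |T| S = -J S |T|`.
  refine mul_right_cancel_of_injective (R := CFC.abs T) (.of_nonneg (CFC.abs_nonneg T))
    (abs_injective hT hinj) ?_
  rw [mul_assoc, hT', h, neg_mul, mul_assoc, hc', ← mul_assoc, hT']

end Sign

/-! ### Calculus of block matrices on `K ⊕ K` -/

section Block

theorem prodL2_ext {K : Type*} {z w : WithLp 2 (K × K)} (h₁ : z.fst = w.fst) (h₂ : z.snd = w.snd) : z = w :=
  (WithLp.ext_iff 2).2 (Prod.ext h₁ h₂)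

variable {K : Type*} [NormedAddCommGroup K] [InnerProductSpace ℂ K]

@[simp] theorem block_apply_fst (x₁₁ x₁₂ x₂₁ x₂₂ : K →L[ℂ] K) (z : WithLp 2 (K × K)) :
    (block x₁₁ x₁₂ x₂₁ x₂₂ z).fst = x₁₁ z.fst + x₁₂ z.snd := rfl

@[simp] theorem block_apply_snd (x₁₁ x₁₂ x₂₁ x₂₂ : K →L[ℂ] K) (z : WithLp 2 (K × K)) :
    (block x₁₁ x₁₂ x₂₁ x₂₂ z).snd = x₂₁ z.fst + x₂₂ z.snd := rfl

theorem block_mul (x₁₁ x₁₂ x₂₁ x₂₂ y₁₁ y₁₂ y₂₁ y₂₂ : K →L[ℂ] K) :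
    block x₁₁ x₁₂ x₂₁ x₂₂ * block y₁₁ y₁₂ y₂₁ y₂₂ =
      block (x₁₁ * y₁₁ + x₁₂ * y₂₁) (x₁₁ * y₁₂ + x₁₂ * y₂₂)
        (x₂₁ * y₁₁ + x₂₂ * y₂₁) (x₂₁ * y₁₂ + x₂₂ * y₂₂) := by
  refine ContinuousLinearMap.ext fun z ↦ prodL2_ext ?_ ?_
  all_goals
    simp
    abel

theorem block_neg (x₁₁ x₁₂ x₂₁ x₂₂ : K →L[ℂ] K) :
    -block x₁₁ x₁₂ x₂₁ x₂₂ = block (-x₁₁) (-x₁₂) (-x₂₁) (-x₂₂) := by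
  refine ContinuousLinearMap.ext fun z ↦ prodL2_ext ?_ ?_
  all_goals
    simp
    abel

theorem block_one : block (1 : K →L[ℂ] K) 0 0 1 = 1 := by
  refine ContinuousLinearMap.ext fun z ↦ prodL2_ext ?_ ?_
  · simp
  · simp

theorem block_injective {x₁₁ x₁₂ x₂₁ x₂₂ y₁₁ y₁₂ y₂₁ y₂₂ : K →L[ℂ] K}
    (h : block x₁₁ x₁₂ x₂₁ x₂₂ = block y₁₁ y₁₂ y₂₁ y₂₂) :
    x₁₁ = y₁₁ ∧ x₁₂ = y₁₂ ∧ x₂₁ = y₂₁ ∧ x₂₂ = y₂₂ := by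
  have hz (z : WithLp 2 (K × K)) := DFunLike.congr_fun h z
  refine ⟨?_, ?_, ?_, ?_⟩ <;> ext x
  · simpa using congrArg WithLp.fst (hz (WithLp.toLp 2 (x, 0)))
  · simpa using congrArg WithLp.fst (hz (WithLp.toLp 2 (0, x)))
  · simpa using congrArg WithLp.snd (hz (WithLp.toLp 2 (x, 0)))
  · simpa using congrArg WithLp.snd (hz (WithLp.toLp 2 (0, x)))

theorem exists_eq_block (S : WithLp 2 (K × K) →L[ℂ] WithLp 2 (K × K)) :
    ∃ s₁₁ s₁₂ s₂₁ s₂₂ : K →L[ℂ] K, S = block s₁₁ s₁₂ s₂₁ s₂₂ := by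
  let e := WithLp.prodContinuousLinearEquiv 2 ℂ K K
  let S' : K × K →L[ℂ] K × K := e.toContinuousLinearMap ∘L S ∘L e.symm.toContinuousLinearMap
  let i₁ := ContinuousLinearMap.inl ℂ K K
  let i₂ := ContinuousLinearMap.inr ℂ K K
  let p₁ := ContinuousLinearMap.fst ℂ K K
  let p₂ := ContinuousLinearMap.snd ℂ K K
  refine ⟨p₁ ∘L S' ∘L i₁, p₁ ∘L S' ∘L i₂, p₂ ∘L S' ∘L i₁, p₂ ∘L S' ∘L i₂, ?_⟩
  refine ContinuousLinearMap.ext fun z ↦ ?_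
  have hz : S z = S (WithLp.toLp 2 (z.fst, 0)) + S (WithLp.toLp 2 (0, z.snd)) := by
    rw [← map_add]
    congr 1
    refine prodL2_ext ?_ ?_
    · exact (add_zero z.fst).symm
    · exact (zero_add z.snd).symm
  rw [hz]
  rfl

theorem adjoint_block [CompleteSpace K] (x₁₁ x₁₂ x₂₁ x₂₂ : K →L[ℂ] K) :
    star (block x₁₁ x₁₂ x₂₁ x₂₂) = block (star x₁₁) (star x₂₁) (star x₁₂) (star x₂₂) := by
  rw [ContinuousLinearMap.star_eq_adjoint]
  symm
  rw [ContinuousLinearMap.eq_adjoint_iff]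
  intro z w
  rw [WithLp.prod_inner_apply, WithLp.prod_inner_apply]
  change ⟪star x₁₁ z.fst + star x₂₁ z.snd, w.fst⟫_ℂ + ⟪star x₁₂ z.fst + star x₂₂ z.snd, w.snd⟫_ℂ =
    ⟪z.fst, x₁₁ w.fst + x₁₂ w.snd⟫_ℂ + ⟪z.snd, x₂₁ w.fst + x₂₂ w.snd⟫_ℂ
  simp only [ContinuousLinearMap.star_eq_adjoint, inner_add_left, inner_add_right,
    ContinuousLinearMap.adjoint_inner_left]
  ring

end Block

/-! ### Canonical form of an anticommuting pair -/

section Model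

variable {E : Type*} [NormedAddCommGroup E] [InnerProductSpace ℂ E] [CompleteSpace E]
variable {K : Type*} [NormedAddCommGroup K] [InnerProductSpace ℂ K]

/-- The unitary `(x, y) ↦ i x + V (i y)` determined by an isometry `i` onto the `1`-eigenspace of a
symmetry `J` and a symmetry `V` that anticommutes with `J`. -/
theorem exists_unitary_of_symmetries {J V : E →L[ℂ] E} (hJ : IsSelfAdjoint J) (hJJ : J * J = 1)
    (hV : IsSelfAdjoint V) (hVV : V * V = 1) (hVJ : V * J = -(J * V)) (i : K →ₗᵢ[ℂ] E)
    (hi : ∀ x, J x = x ↔ x ∈ Set.range i) :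
    ∃ Y : WithLp 2 (K × K) ≃ₗᵢ[ℂ] E, ∀ z, Y z = i z.fst + V (i z.snd) := by
  have hJi (x : K) : J (i x) = i x := (hi _).2 ⟨x, rfl⟩
  have hJJ' (x : E) : J (J x) = x := DFunLike.congr_fun hJJ x
  have hVV' (x : E) : V (V x) = x := DFunLike.congr_fun hVV x
  have hJV (x : E) : J (V x) = -V (J x) := by
    have := DFunLike.congr_fun hVJ x
    simp only [mul_apply_eq_comp, neg_apply] at this
    rw [this, neg_neg]
  have hV_inner (x y : E) : ⟪V x, V y⟫_ℂ = ⟪x, y⟫_ℂ := by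
    rw [← ContinuousLinearMap.adjoint_inner_right, hV.adjoint_eq, hVV']
  -- `V` sends the `1`-eigenspace of `J` into the `-1`-eigenspace, which is orthogonal to it.
  have horth (x y : K) : ⟪i x, V (i y)⟫_ℂ = 0 := by
    have h : ⟪i x, V (i y)⟫_ℂ = -⟪i x, V (i y)⟫_ℂ := by
      conv_lhs => rw [← hJi x, ← ContinuousLinearMap.adjoint_inner_right, hJ.adjoint_eq, hJV, hJi,
        inner_neg_right]
    exact self_eq_neg.1 h
  have horth' (x y : K) : ⟪V (i y), i x⟫_ℂ = 0 := inner_eq_zero_symm.1 (horth x y)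
  let f : WithLp 2 (K × K) →ₗ[ℂ] E :=
    (i.toLinearMap ∘ₗ LinearMap.fst ℂ K K + V.toLinearMap ∘ₗ i.toLinearMap ∘ₗ LinearMap.snd ℂ K K)
      ∘ₗ (WithLp.linearEquiv 2 ℂ (K × K)).toLinearMap
  have hf (z) : f z = i z.fst + V (i z.snd) := rfl
  have hinner (z w) : ⟪f z, f w⟫_ℂ = ⟪z, w⟫_ℂ := by
    rw [hf, hf, inner_add_left, inner_add_right, inner_add_right, horth, horth', hV_inner,
      i.inner_map_map, i.inner_map_map, WithLp.prod_inner_apply, add_zero, zero_add]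
    rfl
  refine ⟨LinearIsometryEquiv.ofSurjective (f.isometryOfInner hinner) fun z ↦ ?_, fun z ↦ rfl⟩
  -- Split `z` into its components `(z ± J z)/2` in the eigenspaces of `J`; `V` brings the second
  -- one back to the `1`-eigenspace.
  obtain ⟨x, hx⟩ := (hi ((2⁻¹ : ℂ) • (z + J z))).1 (by
    rw [map_smul, map_add, hJJ', add_comm])
  obtain ⟨y, hy⟩ := (hi ((2⁻¹ : ℂ) • V (z - J z))).1 (by
    rw [map_smul, hJV, map_sub J, hJJ', ← map_neg, neg_sub])
  refine ⟨WithLp.toLp 2 (x, y), ?_⟩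
  change i x + V (i y) = z
  rw [hx, hy, map_smul, hVV']
  module

/-- The signs of `A` and `B` supply the symmetries `J` and `V`. The space `K` may be any isometric
copy of the `1`-eigenspace of `J`, which later allows a subspace of `H` itself. -/
theorem exists_anticommuting_model {A B : E →L[ℂ] E} (hA : IsSelfAdjoint A) (hB : IsSelfAdjoint B)
    (hA0 : ∀ x, A x = 0 → x = 0) (hB0 : ∀ x, B x = 0 → x = 0) (hBA : B * A = -(A * B))
    (hAB : A * A + B * B = 1) :
    ∃ J : E →L[ℂ] E, IsClosed {x | J x = x} ∧
      ∀ (K : Type _) [NormedAddCommGroup K] [InnerProductSpace ℂ K] [CompleteSpace K]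
        (i : K →ₗᵢ[ℂ] E), (∀ x, J x = x ↔ x ∈ Set.range i) →
      ∃ (a : K →L[ℂ] K) (Y : WithLp 2 (K × K) ≃ₗᵢ[ℂ] E), IsSelfAdjoint a ∧
        (∀ x : K, x ≠ 0 → 0 < RCLike.re ⟪a x, x⟫_ℂ) ∧ spectrum ℝ a ⊆ Set.Icc 0 1 ∧
        ¬ Module.End.HasEigenvalue (a : K →ₗ[ℂ] K) 1 ∧
        (∀ z, A (Y z) = Y (block a 0 0 (-a) z)) ∧
        ∀ z, B (Y z) =
          Y (block 0 (CFC.sqrt (1 - a ^ 2)) (CFC.sqrt (1 - a ^ 2)) 0 z) := by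
  obtain ⟨J, hJ, hJJ, hJA⟩ := exists_sign hA
  obtain ⟨V, hV, hVV, hVB⟩ := exists_sign hB
  refine ⟨J, isClosed_eq J.continuous continuous_id, fun K _ _ _ i hi ↦ ?_⟩
  have hAV : A * V = -(V * A) :=
    anticommute_sign hB hB0 hVV hVB (by rw [hBA, neg_neg])
  have hVJ : V * J = -(J * V) := anticommute_sign hA hA0 hJJ hJA (by rw [hAV, neg_neg])
  have hBJ : B * J = -(J * B) := anticommute_sign hA hA0 hJJ hJA hBA
  have habsA : IsSelfAdjoint (CFC.abs A) := .of_nonneg (CFC.abs_nonneg A)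
  have habsB : IsSelfAdjoint (CFC.abs B) := .of_nonneg (CFC.abs_nonneg B)
  have hAJ : A * J = CFC.abs A := by
    have := congrArg star hJA
    rwa [star_mul, hA.star_eq, hJ.star_eq, habsA.star_eq] at this
  have hBV : B * V = CFC.abs B := by
    have := congrArg star hVB
    rwa [star_mul, hB.star_eq, hV.star_eq, habsB.star_eq] at this
  have hJB : Commute J (CFC.abs B) := by
    refine commute_abs hB ?_
    have hJB' : J * B = -(B * J) := by rw [hBJ, neg_neg]
    rw [Commute, SemiconjBy, ← mul_assoc, hJB', neg_mul, mul_assoc, hJB', mul_neg, neg_neg,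
      mul_assoc]
  obtain ⟨Y, hY⟩ := exists_unitary_of_symmetries hJ hJJ hV hVV hVJ i hi
  have hJi (x : K) : J (i x) = i x := (hi _).2 ⟨x, rfl⟩
  have hVV' (x : E) : V (V x) = x := DFunLike.congr_fun hVV x
  let j : E →L[ℂ] K := i.toContinuousLinearMap.adjoint
  have hji (x : K) : j (i x) = x := DFunLike.congr_fun i.adjoint_comp_self x
  -- An operator commuting with `J` preserves its `1`-eigenspace, so its compression there is a
  -- restriction.
  have hcompress {T : E →L[ℂ] E} (hT : Commute J T) (x : K) : i (j (T (i x))) = T (i x) := by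
    obtain ⟨y, hy⟩ := (hi (T (i x))).1 (by
      have := DFunLike.congr_fun hT.eq (i x)
      simp only [mul_apply_eq_comp, hJi] at this
      exact this)
    rw [← hy, hji]
  have hJA' : Commute J A := by rw [Commute, SemiconjBy, hJA, hAJ]
  let a : K →L[ℂ] K := j ∘L A ∘L i.toContinuousLinearMap
  let c : K →L[ℂ] K := j ∘L CFC.abs B ∘L i.toContinuousLinearMap
  have hia (x : K) : i (a x) = A (i x) := hcompress hJA' x
  have hic (x : K) : i (c x) = CFC.abs B (i x) := hcompress hJB x
  have ha : IsSelfAdjoint a := hA.adjoint_conj i.toContinuousLinearMap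
  have hc : 0 ≤ c := (ContinuousLinearMap.nonneg_iff_isPositive c).2
    (((ContinuousLinearMap.nonneg_iff_isPositive _).1 (CFC.abs_nonneg B)).adjoint_conj
      i.toContinuousLinearMap)
  -- Since `|A| = A J`, the operators `A` and `|A|` agree on the `1`-eigenspace; this makes `a`
  -- positive.
  have ha' : a = j ∘L CFC.abs A ∘L i.toContinuousLinearMap := by
    ext x
    change j (A (i x)) = j (CFC.abs A (i x))
    rw [← hAJ]
    simp only [mul_apply_eq_comp, hJi]
  have ha0 : 0 ≤ a := (ContinuousLinearMap.nonneg_iff_isPositive a).2 (by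
    rw [ha']
    exact ((ContinuousLinearMap.nonneg_iff_isPositive _).1 (CFC.abs_nonneg A)).adjoint_conj
      i.toContinuousLinearMap)
  have hAB' (x : E) : A (A x) + B (B x) = x := DFunLike.congr_fun hAB x
  have hBB (x : E) : CFC.abs B (CFC.abs B x) = B (B x) :=
    DFunLike.congr_fun (abs_mul_abs_of_isSelfAdjoint hB) x
  -- `c` is nonnegative and `c² = 1 - a²` is the restriction of `B² = 1 - A²`.
  have hsqrt : CFC.sqrt (1 - a ^ 2) = c := by
    refine CFC.sqrt_unique (ContinuousLinearMap.ext fun x ↦ i.injective ?_) hc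
    simp only [mul_apply_eq_comp, pow_two, sub_apply, one_apply_eq_self,
      map_sub, hia, hic, hBB]
    exact eq_sub_of_add_eq' (hAB' _)
  have hnorm (x : E) : ‖A x‖ ≤ ‖x‖ := by
    have h1 : ⟪A x, A x⟫_ℂ + ⟪B x, B x⟫_ℂ = ⟪x, x⟫_ℂ := by
      rw [← ContinuousLinearMap.adjoint_inner_left, hA.adjoint_eq,
        ← ContinuousLinearMap.adjoint_inner_left, hB.adjoint_eq, ← inner_add_left, hAB']
    simp only [inner_self_eq_norm_sq_to_K] at h1
    norm_cast at h1
    nlinarith [sq_nonneg ‖B x‖, norm_nonneg x, norm_nonneg (A x)]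
  have hanorm : ‖a‖ ≤ 1 := a.opNorm_le_bound zero_le_one fun x ↦ by
    rw [← i.norm_map, hia, one_mul, ← i.norm_map x]
    exact hnorm _
  refine ⟨a, Y, ha, fun x hx ↦ re_inner_pos_of_nonneg ha0 (fun y hy ↦ ?_) hx, fun r hr ↦ ?_, ?_,
    fun z ↦ ?_, fun z ↦ ?_⟩
  · have : A (i y) = 0 := by rw [← hia, hy, map_zero]
    exact i.injective (by rw [hA0 _ this, map_zero])
  · refine ⟨spectrum_nonneg_of_nonneg ha0 hr, ?_⟩
    have h1 : a ≤ 1 := (CStarAlgebra.norm_le_one_iff_of_nonneg a).1 hanorm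
    exact (CFC.le_one_iff (R := ℝ) a).1 h1 r hr
  -- If `A` fixes a vector, then `A² + B² = 1` makes `B²` kill it, and `B` is injective.
  · intro h
    obtain ⟨x, hx⟩ := h.exists_hasEigenvector
    have hax : A (i x) = i x := by
      rw [← hia]
      exact congrArg i (hx.apply_eq_smul.trans (one_smul _ _))
    have hb : B (B (i x)) = 0 := by
      have := hAB' (i x)
      rwa [hax, hax, add_eq_left] at this
    exact hx.2 (i.injective ((hB0 _ (hB0 _ hb)).trans (map_zero i).symm))
  · rw [hY, hY, block_apply_fst, block_apply_snd]
    have h := DFunLike.congr_fun hAV (i z.snd)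
    simp only [mul_apply_eq_comp, neg_apply] at h
    simp [hia, h]
  · have h1 := DFunLike.congr_fun hBV (i z.snd)
    simp only [mul_apply_eq_comp] at h1
    have h2 := DFunLike.congr_fun hVB (i z.fst)
    simp only [mul_apply_eq_comp] at h2
    rw [hY, hY, block_apply_fst, block_apply_snd, hsqrt]
    simp [hic, h1, ← h2, hVV', add_comm]

end Model

/-! ### The orthogonal decomposition of `H` and direct sums along it -/

section Parts

variable {H : Type*} [NormedAddCommGroup H] [InnerProductSpace ℂ H] [CompleteSpace H]
variable {P Q : H →L[ℂ] H}

theorem apply_apply_of_isStarProjection (hP : IsStarProjection P) (x : H) : P (P x) = P x :=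
  DFunLike.congr_fun hP.isIdempotentElem.eq x

theorem mem_range_iff_of_isStarProjection (hP : IsStarProjection P) {x : H} :
    x ∈ P.range ↔ P x = x :=
  ⟨by rintro ⟨y, rfl⟩; exact apply_apply_of_isStarProjection hP y, fun h ↦ ⟨x, h⟩⟩

theorem mem_M00 (hP : IsStarProjection P) (hQ : IsStarProjection Q) {x : H} :
    x ∈ M00 P Q ↔ P x = x ∧ Q x = x := by
  rw [M00, Submodule.mem_inf, mem_range_iff_of_isStarProjection hP,
    mem_range_iff_of_isStarProjection hQ]

theorem mem_M01 (hP : IsStarProjection P) {x : H} : x ∈ M01 P Q ↔ P x = x ∧ Q x = 0 := by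
  rw [M01, Submodule.mem_inf, mem_range_iff_of_isStarProjection hP]
  rfl

theorem mem_M10 (hQ : IsStarProjection Q) {x : H} : x ∈ M10 P Q ↔ Q x = x ∧ P x = 0 := by
  rw [M10, Submodule.mem_inf, mem_range_iff_of_isStarProjection hQ]
  rfl

omit [CompleteSpace H] in
theorem mem_M11 {x : H} : x ∈ M11 P Q ↔ P x = 0 ∧ Q x = 0 := Iff.rfl

omit [CompleteSpace H] in
theorem isOrtho_generic :
    M00 P Q ⟂ generic P Q ∧ M01 P Q ⟂ generic P Q ∧ M10 P Q ⟂ generic P Q ∧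
      M11 P Q ⟂ generic P Q := by
  have h : (M00 P Q ⊔ M01 P Q ⊔ M10 P Q ⊔ M11 P Q) ⟂ generic P Q :=
    Submodule.isOrtho_orthogonal_right _
  simpa only [Submodule.isOrtho_sup_left, and_assoc] using h

omit [CompleteSpace H] in
theorem mem_generic {x : H} :
    x ∈ generic P Q ↔
      x ∈ (M00 P Q)ᗮ ∧ x ∈ (M01 P Q)ᗮ ∧ x ∈ (M10 P Q)ᗮ ∧ x ∈ (M11 P Q)ᗮ := by
  simp only [generic, ← Submodule.inf_orthogonal, Submodule.mem_inf, and_assoc]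

theorem inner_eq_zero_of_isStarProjection (hP : IsStarProjection P) {x y : H} (hx : P x = x)
    (hy : P y = 0) : ⟪x, y⟫_ℂ = 0 := by
  rw [← hx, ← ContinuousLinearMap.adjoint_inner_right, hP.isSelfAdjoint.adjoint_eq, hy,
    inner_zero_right]

theorem isOrtho_M00_M01 (hP : IsStarProjection P) (hQ : IsStarProjection Q) :
    M00 P Q ⟂ M01 P Q :=
  Submodule.isOrtho_iff_inner_eq.2 fun _ hx _ hy ↦ inner_eq_zero_of_isStarProjection hQ
    ((mem_M00 hP hQ).1 hx).2 ((mem_M01 hP).1 hy).2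

theorem isOrtho_M00_M10 (hP : IsStarProjection P) (hQ : IsStarProjection Q) :
    M00 P Q ⟂ M10 P Q :=
  Submodule.isOrtho_iff_inner_eq.2 fun _ hx _ hy ↦ inner_eq_zero_of_isStarProjection hP
    ((mem_M00 hP hQ).1 hx).1 ((mem_M10 hQ).1 hy).2

theorem isOrtho_M00_M11 (hP : IsStarProjection P) (hQ : IsStarProjection Q) :
    M00 P Q ⟂ M11 P Q :=
  Submodule.isOrtho_iff_inner_eq.2 fun _ hx _ hy ↦ inner_eq_zero_of_isStarProjection hP
    ((mem_M00 hP hQ).1 hx).1 (mem_M11.1 hy).1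

theorem isOrtho_M01_M10 (hP : IsStarProjection P) (hQ : IsStarProjection Q) :
    M01 P Q ⟂ M10 P Q :=
  Submodule.isOrtho_iff_inner_eq.2 fun _ hx _ hy ↦ inner_eq_zero_of_isStarProjection hP
    ((mem_M01 hP).1 hx).1 ((mem_M10 hQ).1 hy).2

theorem isOrtho_M01_M11 (hP : IsStarProjection P) : M01 P Q ⟂ M11 P Q :=
  Submodule.isOrtho_iff_inner_eq.2 fun _ hx _ hy ↦ inner_eq_zero_of_isStarProjection hP
    ((mem_M01 hP).1 hx).1 (mem_M11.1 hy).1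

theorem isOrtho_M10_M11 (hQ : IsStarProjection Q) : M10 P Q ⟂ M11 P Q :=
  Submodule.isOrtho_iff_inner_eq.2 fun _ hx _ hy ↦ inner_eq_zero_of_isStarProjection hQ
    ((mem_M10 hQ).1 hx).1 (mem_M11.1 hy).2

/-- Operators that agree on `M₀₀`, `M₀₁`, `M₁₀`, `M₁₁` and the generic part are equal. -/
theorem eq_of_eqOn_parts (hP : IsStarProjection P) (hQ : IsStarProjection Q)
    {S T : H →L[ℂ] H} (h₀₀ : ∀ x : M00 P Q, S x = T x) (h₀₁ : ∀ x : M01 P Q, S x = T x)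
    (h₁₀ : ∀ x : M10 P Q, S x = T x) (h₁₁ : ∀ x : M11 P Q, S x = T x)
    (hG : ∀ x : generic P Q, S x = T x) : S = T := by
  have := hasOrthogonalProjection_M00 hP hQ
  have := hasOrthogonalProjection_M01 Q hP
  have := hasOrthogonalProjection_M10 P hQ
  have := hasOrthogonalProjection_M11 P Q
  have h1 := isOrtho_M00_M01 hP hQ
  have h2 := isOrtho_M00_M10 hP hQ
  have h3 := isOrtho_M00_M11 hP hQ
  have h4 := isOrtho_M01_M10 hP hQ
  have h5 := isOrtho_M01_M11 (Q := Q) hP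
  have h6 := isOrtho_M10_M11 (P := P) hQ
  ext x
  let x₀ := (M00 P Q).starProjection x
  let x₁ := (M01 P Q).starProjection x
  let x₂ := (M10 P Q).starProjection x
  let x₃ := (M11 P Q).starProjection x
  have m₀ : x₀ ∈ M00 P Q := Submodule.starProjection_apply_mem _ _
  have m₁ : x₁ ∈ M01 P Q := Submodule.starProjection_apply_mem _ _
  have m₂ : x₂ ∈ M10 P Q := Submodule.starProjection_apply_mem _ _
  have m₃ : x₃ ∈ M11 P Q := Submodule.starProjection_apply_mem _ _
  -- In each of the four cases, the component in the subspace at hand is subtracted first; the other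
  -- three are already orthogonal to it.
  have mG : x - x₀ - x₁ - x₂ - x₃ ∈ generic P Q := by
    refine mem_generic.2 ⟨?_, ?_, ?_, ?_⟩
    · refine sub_mem (sub_mem (sub_mem ?_ (h1.symm m₁)) (h2.symm m₂)) (h3.symm m₃)
      exact Submodule.sub_starProjection_mem_orthogonal x
    · rw [show x - x₀ - x₁ - x₂ - x₃ = (x - x₁) - x₀ - x₂ - x₃ by abel]
      refine sub_mem (sub_mem (sub_mem ?_ (h1 m₀)) (h4.symm m₂)) (h5.symm m₃)
      exact Submodule.sub_starProjection_mem_orthogonal x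
    · rw [show x - x₀ - x₁ - x₂ - x₃ = (x - x₂) - x₀ - x₁ - x₃ by abel]
      refine sub_mem (sub_mem (sub_mem ?_ (h2 m₀)) (h4 m₁)) (h6.symm m₃)
      exact Submodule.sub_starProjection_mem_orthogonal x
    · rw [show x - x₀ - x₁ - x₂ - x₃ = (x - x₃) - x₀ - x₁ - x₂ by abel]
      refine sub_mem (sub_mem (sub_mem ?_ (h3 m₀)) (h5 m₁)) (h6 m₂)
      exact Submodule.sub_starProjection_mem_orthogonal x
  have hx : x = x₀ + x₁ + x₂ + x₃ + (x - x₀ - x₁ - x₂ - x₃) := by abel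
  rw [hx]
  simp only [map_add]
  rw [h₀₀ ⟨_, m₀⟩, h₀₁ ⟨_, m₁⟩, h₁₀ ⟨_, m₂⟩, h₁₁ ⟨_, m₃⟩, hG ⟨_, mG⟩]

section DirectSum

variable (hP : IsStarProjection P) (hQ : IsStarProjection Q)
  (U₀ : M00 P Q →L[ℂ] M00 P Q) (U₁₀ : M01 P Q →L[ℂ] M10 P Q) (U₀₁ : M10 P Q →L[ℂ] M01 P Q)
  (U₁ : M11 P Q →L[ℂ] M11 P Q) (T : generic P Q →L[ℂ] generic P Q)

theorem directSum_apply_M00 (x : M00 P Q) : directSum hP hQ U₀ U₁₀ U₀₁ U₁ T x = U₀ x := by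
  have := hasOrthogonalProjection_M00 hP hQ
  have := hasOrthogonalProjection_M01 Q hP
  have := hasOrthogonalProjection_M10 P hQ
  have := hasOrthogonalProjection_M11 P Q
  have h1 := Submodule.orthogonalProjectionOnto_eq_zero_iff.2 (isOrtho_M00_M01 hP hQ x.2)
  have h2 := Submodule.orthogonalProjectionOnto_eq_zero_iff.2 (isOrtho_M00_M10 hP hQ x.2)
  have h3 := Submodule.orthogonalProjectionOnto_eq_zero_iff.2 (isOrtho_M00_M11 hP hQ x.2)
  have h4 := Submodule.orthogonalProjectionOnto_eq_zero_iff.2 (isOrtho_generic.1 x.2)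
  simp [directSum, h1, h2, h3, h4]

theorem directSum_apply_M01 (x : M01 P Q) : directSum hP hQ U₀ U₁₀ U₀₁ U₁ T x = U₁₀ x := by
  have := hasOrthogonalProjection_M00 hP hQ
  have := hasOrthogonalProjection_M01 Q hP
  have := hasOrthogonalProjection_M10 P hQ
  have := hasOrthogonalProjection_M11 P Q
  have h1 := Submodule.orthogonalProjectionOnto_eq_zero_iff.2 ((isOrtho_M00_M01 hP hQ).symm x.2)
  have h2 := Submodule.orthogonalProjectionOnto_eq_zero_iff.2 (isOrtho_M01_M10 hP hQ x.2)
  have h3 := Submodule.orthogonalProjectionOnto_eq_zero_iff.2 (isOrtho_M01_M11 hP x.2)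
  have h4 := Submodule.orthogonalProjectionOnto_eq_zero_iff.2 (isOrtho_generic.2.1 x.2)
  simp [directSum, h1, h2, h3, h4]

theorem directSum_apply_M10 (x : M10 P Q) : directSum hP hQ U₀ U₁₀ U₀₁ U₁ T x = U₀₁ x := by
  have := hasOrthogonalProjection_M00 hP hQ
  have := hasOrthogonalProjection_M01 Q hP
  have := hasOrthogonalProjection_M10 P hQ
  have := hasOrthogonalProjection_M11 P Q
  have h1 := Submodule.orthogonalProjectionOnto_eq_zero_iff.2 ((isOrtho_M00_M10 hP hQ).symm x.2)
  have h2 := Submodule.orthogonalProjectionOnto_eq_zero_iff.2 ((isOrtho_M01_M10 hP hQ).symm x.2)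
  have h3 := Submodule.orthogonalProjectionOnto_eq_zero_iff.2 (isOrtho_M10_M11 hQ x.2)
  have h4 := Submodule.orthogonalProjectionOnto_eq_zero_iff.2 (isOrtho_generic.2.2.1 x.2)
  simp [directSum, h1, h2, h3, h4]

theorem directSum_apply_M11 (x : M11 P Q) : directSum hP hQ U₀ U₁₀ U₀₁ U₁ T x = U₁ x := by
  have := hasOrthogonalProjection_M00 hP hQ
  have := hasOrthogonalProjection_M01 Q hP
  have := hasOrthogonalProjection_M10 P hQ
  have := hasOrthogonalProjection_M11 P Q
  have h1 := Submodule.orthogonalProjectionOnto_eq_zero_iff.2 ((isOrtho_M00_M11 hP hQ).symm x.2)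
  have h2 := Submodule.orthogonalProjectionOnto_eq_zero_iff.2 ((isOrtho_M01_M11 hP).symm x.2)
  have h3 := Submodule.orthogonalProjectionOnto_eq_zero_iff.2 ((isOrtho_M10_M11 hQ).symm x.2)
  have h4 := Submodule.orthogonalProjectionOnto_eq_zero_iff.2 (isOrtho_generic.2.2.2 x.2)
  simp [directSum, h1, h2, h3, h4]

theorem directSum_apply_generic (x : generic P Q) :
    directSum hP hQ U₀ U₁₀ U₀₁ U₁ T x = T x := by
  have := hasOrthogonalProjection_M00 hP hQ
  have := hasOrthogonalProjection_M01 Q hP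
  have := hasOrthogonalProjection_M10 P hQ
  have := hasOrthogonalProjection_M11 P Q
  obtain ⟨m₀, m₁, m₂, m₃⟩ := mem_generic.1 x.2
  have h1 := Submodule.orthogonalProjectionOnto_eq_zero_iff.2 m₀
  have h2 := Submodule.orthogonalProjectionOnto_eq_zero_iff.2 m₁
  have h3 := Submodule.orthogonalProjectionOnto_eq_zero_iff.2 m₂
  have h4 := Submodule.orthogonalProjectionOnto_eq_zero_iff.2 m₃
  simp [directSum, h1, h2, h3, h4]

end DirectSum

instance completeSpace_generic (P Q : H →L[ℂ] H) : CompleteSpace (generic P Q) :=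
  Submodule.instOrthogonalCompleteSpace _

/-- Taking adjoints exchanges the two off-diagonal corners: the inverse of `U₀₁` goes from `M01` to
`M10`, and that of `U₁₀` the other way. -/
theorem star_directSum (hP : IsStarProjection P) (hQ : IsStarProjection Q)
    (U₀ : M00 P Q ≃ₗᵢ[ℂ] M00 P Q) (U₁₀ : M01 P Q ≃ₗᵢ[ℂ] M10 P Q) (U₀₁ : M10 P Q ≃ₗᵢ[ℂ] M01 P Q)
    (U₁ : M11 P Q ≃ₗᵢ[ℂ] M11 P Q) (T : generic P Q →L[ℂ] generic P Q) :
    star (directSum hP hQ (U₀ : M00 P Q →L[ℂ] M00 P Q) (U₁₀ : M01 P Q →L[ℂ] M10 P Q)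
      (U₀₁ : M10 P Q →L[ℂ] M01 P Q) (U₁ : M11 P Q →L[ℂ] M11 P Q) T) =
    directSum hP hQ (U₀.symm : M00 P Q →L[ℂ] M00 P Q) (U₀₁.symm : M01 P Q →L[ℂ] M10 P Q)
      (U₁₀.symm : M10 P Q →L[ℂ] M01 P Q) (U₁.symm : M11 P Q →L[ℂ] M11 P Q) (star T) := by
  have := hasOrthogonalProjection_M00 hP hQ
  have := hasOrthogonalProjection_M01 Q hP
  have := hasOrthogonalProjection_M10 P hQ
  have := hasOrthogonalProjection_M11 P Q
  have : CompleteSpace (M00 P Q) := ((isClosed_range_of_isStarProjection hP).inter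
    (isClosed_range_of_isStarProjection hQ)).completeSpace_coe
  have : CompleteSpace (M01 P Q) :=
    ((isClosed_range_of_isStarProjection hP).inter Q.isClosed_ker).completeSpace_coe
  have : CompleteSpace (M10 P Q) :=
    ((isClosed_range_of_isStarProjection hQ).inter P.isClosed_ker).completeSpace_coe
  have : CompleteSpace (M11 P Q) := (P.isClosed_ker.inter Q.isClosed_ker).completeSpace_coe
  simp only [directSum, ContinuousLinearMap.star_eq_adjoint, map_add,
    ContinuousLinearMap.adjoint_comp, Submodule.adjoint_subtypeL,
    Submodule.adjoint_orthogonalProjectionOnto, LinearIsometryEquiv.adjoint_eq_symm,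
    ContinuousLinearMap.comp_assoc]
  abel

theorem directSum_mem_unitary (hP : IsStarProjection P) (hQ : IsStarProjection Q)
    (U₀ : M00 P Q ≃ₗᵢ[ℂ] M00 P Q) (U₁₀ : M01 P Q ≃ₗᵢ[ℂ] M10 P Q) (U₀₁ : M10 P Q ≃ₗᵢ[ℂ] M01 P Q)
    (U₁ : M11 P Q ≃ₗᵢ[ℂ] M11 P Q) {T : generic P Q →L[ℂ] generic P Q}
    (hT : T ∈ unitary (generic P Q →L[ℂ] generic P Q)) :
    directSum hP hQ (U₀ : M00 P Q →L[ℂ] M00 P Q) (U₁₀ : M01 P Q →L[ℂ] M10 P Q)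
      (U₀₁ : M10 P Q →L[ℂ] M01 P Q) (U₁ : M11 P Q →L[ℂ] M11 P Q) T ∈ unitary (H →L[ℂ] H) := by
  rw [Unitary.mem_iff, star_directSum]
  constructor
  · refine eq_of_eqOn_parts hP hQ ?_ ?_ ?_ ?_ ?_ <;> intro x
    · simp [directSum_apply_M00]
    · simp [directSum_apply_M01, directSum_apply_M10]
    · simp [directSum_apply_M01, directSum_apply_M10]
    · simp [directSum_apply_M11]
    · have := DFunLike.congr_fun (Unitary.mem_iff.1 hT).1 x
      simp only [mul_apply_eq_comp, one_apply_eq_self] at this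
      simp [directSum_apply_generic, this]
  · refine eq_of_eqOn_parts hP hQ ?_ ?_ ?_ ?_ ?_ <;> intro x
    · simp [directSum_apply_M00]
    · simp [directSum_apply_M01, directSum_apply_M10]
    · simp [directSum_apply_M01, directSum_apply_M10]
    · simp [directSum_apply_M11]
    · have := DFunLike.congr_fun (Unitary.mem_iff.1 hT).2 x
      simp only [mul_apply_eq_comp, one_apply_eq_self] at this
      simp [directSum_apply_generic, this]

/-- An operator maps the generic part into itself if its adjoint preserves the span of the others. -/
theorem map_mem_generic {T : H →L[ℂ] H}
    (h₀₀ : ∀ x ∈ M00 P Q, star T x ∈ M00 P Q ⊔ M01 P Q ⊔ M10 P Q ⊔ M11 P Q)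
    (h₀₁ : ∀ x ∈ M01 P Q, star T x ∈ M00 P Q ⊔ M01 P Q ⊔ M10 P Q ⊔ M11 P Q)
    (h₁₀ : ∀ x ∈ M10 P Q, star T x ∈ M00 P Q ⊔ M01 P Q ⊔ M10 P Q ⊔ M11 P Q)
    (h₁₁ : ∀ x ∈ M11 P Q, star T x ∈ M00 P Q ⊔ M01 P Q ⊔ M10 P Q ⊔ M11 P Q)
    {x : H} (hx : x ∈ generic P Q) : T x ∈ generic P Q := by
  have h : M00 P Q ⊔ M01 P Q ⊔ M10 P Q ⊔ M11 P Q ≤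
      (M00 P Q ⊔ M01 P Q ⊔ M10 P Q ⊔ M11 P Q).comap (star T).toLinearMap :=
    sup_le (sup_le (sup_le h₀₀ h₀₁) h₁₀) h₁₁
  refine (Submodule.mem_orthogonal _ _).2 fun y hy ↦ ?_
  rw [← ContinuousLinearMap.adjoint_inner_left]
  exact (Submodule.mem_orthogonal _ _).1 hx _ (h hy)

omit [CompleteSpace H] in
theorem M00_le_sup : M00 P Q ≤ M00 P Q ⊔ M01 P Q ⊔ M10 P Q ⊔ M11 P Q :=
  le_sup_of_le_left (le_sup_of_le_left le_sup_left)

omit [CompleteSpace H] in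
theorem M01_le_sup : M01 P Q ≤ M00 P Q ⊔ M01 P Q ⊔ M10 P Q ⊔ M11 P Q :=
  le_sup_of_le_left (le_sup_of_le_left le_sup_right)

omit [CompleteSpace H] in
theorem M10_le_sup : M10 P Q ≤ M00 P Q ⊔ M01 P Q ⊔ M10 P Q ⊔ M11 P Q :=
  le_sup_of_le_left le_sup_right

omit [CompleteSpace H] in
theorem M11_le_sup : M11 P Q ≤ M00 P Q ⊔ M01 P Q ⊔ M10 P Q ⊔ M11 P Q :=
  le_sup_right

end Parts

/-! ### Existence of the canonical form -/

section Existence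

variable {H : Type*} [NormedAddCommGroup H] [InnerProductSpace ℂ H] [CompleteSpace H]
variable {P Q : H →L[ℂ] H}

/-- `P` is self-adjoint and acts as `0` or `1` on each special subspace. -/
theorem left_map_generic (hP : IsStarProjection P) (hQ : IsStarProjection Q) {x : H}
    (hx : x ∈ generic P Q) : P x ∈ generic P Q := by
  refine map_mem_generic ?_ ?_ ?_ ?_ hx <;> intro y hy <;> rw [hP.isSelfAdjoint.star_eq]
  · rw [((mem_M00 hP hQ).1 hy).1]; exact M00_le_sup hy
  · rw [((mem_M01 hP).1 hy).1]; exact M01_le_sup hy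
  · rw [((mem_M10 hQ).1 hy).2]; exact zero_mem _
  · rw [(mem_M11.1 hy).1]; exact zero_mem _

theorem right_map_generic (hP : IsStarProjection P) (hQ : IsStarProjection Q) {x : H}
    (hx : x ∈ generic P Q) : Q x ∈ generic P Q := by
  refine map_mem_generic ?_ ?_ ?_ ?_ hx <;> intro y hy <;> rw [hQ.isSelfAdjoint.star_eq]
  · rw [((mem_M00 hP hQ).1 hy).2]; exact M00_le_sup hy
  · rw [((mem_M01 hP).1 hy).2]; exact zero_mem _
  · rw [((mem_M10 hQ).1 hy).1]; exact M10_le_sup hy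
  · rw [(mem_M11.1 hy).2]; exact zero_mem _

omit [CompleteSpace H] in
theorem eq_zero_of_mem_sup_of_mem_generic {x : H}
    (h : x ∈ M00 P Q ⊔ M01 P Q ⊔ M10 P Q ⊔ M11 P Q) (hx : x ∈ generic P Q) : x = 0 :=
  inner_self_eq_zero.1 ((Submodule.mem_orthogonal _ _).1 hx x h)

/-- If `P x = Q x`, then `x = P x + (x - P x)` has its first term in `M00` and its second in `M11`,
so it is orthogonal to itself. -/
theorem eq_zero_of_sub_apply_eq_zero (hP : IsStarProjection P) (hQ : IsStarProjection Q) {x : H}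
    (hx : x ∈ generic P Q) (h : (P - Q) x = 0) : x = 0 := by
  have h' : P x = Q x := sub_eq_zero.1 h
  have hPP := apply_apply_of_isStarProjection hP x
  have hQQ := apply_apply_of_isStarProjection hQ x
  refine eq_zero_of_mem_sup_of_mem_generic ?_ hx
  rw [← add_sub_cancel (P x) x]
  refine add_mem (M00_le_sup ((mem_M00 hP hQ).2 ⟨hPP, ?_⟩)) (M11_le_sup (mem_M11.2 ⟨?_, ?_⟩))
  · rw [h', hQQ]
  · rw [map_sub, hPP, sub_self]
  · rw [map_sub, h', hQQ, sub_self]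

/-- Applying `P` and `Q` to `x = P x + Q x` gives `P Q x = 0` and `Q P x = 0`, so the terms lie in
`M01` and `M10`. -/
theorem eq_zero_of_one_sub_sub_apply_eq_zero (hP : IsStarProjection P) (hQ : IsStarProjection Q)
    {x : H} (hx : x ∈ generic P Q) (h : (1 - P - Q) x = 0) : x = 0 := by
  have hPP := apply_apply_of_isStarProjection hP x
  have hQQ := apply_apply_of_isStarProjection hQ x
  have h' : x = P x + Q x := by
    simp only [sub_apply, one_apply_eq_self, sub_sub] at h
    exact sub_eq_zero.1 h
  have hPQ : P (Q x) = 0 := by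
    have := congrArg P h'
    rwa [map_add, hPP, left_eq_add] at this
  have hQP : Q (P x) = 0 := by
    have := congrArg Q h'
    rwa [map_add, hQQ, right_eq_add] at this
  refine eq_zero_of_mem_sup_of_mem_generic ?_ hx
  rw [h']
  exact add_mem (M01_le_sup ((mem_M01 hP).2 ⟨hPP, hQP⟩)) (M10_le_sup ((mem_M10 hQ).2 ⟨hQQ, hPQ⟩))

theorem exists_isCanonicalForm (hP : IsStarProjection P) (hQ : IsStarProjection Q) :
    ∃ (K : Submodule ℂ H) (_ : CompleteSpace K) (a : K →L[ℂ] K)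
      (Y : WithLp 2 (K × K) ≃ₗᵢ[ℂ] generic P Q), IsCanonicalForm P Q a Y := by
  let G := generic P Q
  -- Written as a compression, so that self-adjointness is inherited; on an operator preserving `G`
  -- it is the restriction.
  let restrict (T : H →L[ℂ] H) : G →L[ℂ] G := G.orthogonalProjectionOnto ∘L T ∘L G.subtypeL
  have hrestrict {T : H →L[ℂ] H} (hT : ∀ x ∈ G, T x ∈ G) (x : G) : (restrict T x : H) = T x :=
    Submodule.starProjection_eq_self_iff.2 (hT x x.2)
  have hadj {T : H →L[ℂ] H} (hT : IsSelfAdjoint T) : IsSelfAdjoint (restrict T) := by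
    have := hT.adjoint_conj G.subtypeL
    rwa [Submodule.adjoint_subtypeL] at this
  have hPG (x) (hx : x ∈ G) : P x ∈ G := left_map_generic hP hQ hx
  have hQG (x) (hx : x ∈ G) : Q x ∈ G := right_map_generic hP hQ hx
  have hAG (x) (hx : x ∈ G) : (P - Q) x ∈ G := sub_mem (hPG x hx) (hQG x hx)
  have hBG (x) (hx : x ∈ G) : (1 - P - Q) x ∈ G := sub_mem (sub_mem hx (hPG x hx)) (hQG x hx)
  have hPP := apply_apply_of_isStarProjection hP
  have hQQ := apply_apply_of_isStarProjection hQ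
  obtain ⟨J, hJc, hJ⟩ := exists_anticommuting_model (A := restrict (P - Q))
    (B := restrict (1 - P - Q)) (hadj (hP.isSelfAdjoint.sub hQ.isSelfAdjoint))
    (hadj (((IsSelfAdjoint.one _).sub hP.isSelfAdjoint).sub hQ.isSelfAdjoint))
    (fun x hx ↦ Subtype.ext (eq_zero_of_sub_apply_eq_zero hP hQ x.2 (by
      rw [← hrestrict hAG, hx]; rfl)))
    (fun x hx ↦ Subtype.ext (eq_zero_of_one_sub_sub_apply_eq_zero hP hQ x.2 (by
      rw [← hrestrict hBG, hx]; rfl)))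
    (by
      ext x
      simp only [mul_apply_eq_comp, neg_apply, Submodule.coe_neg, hrestrict hAG, hrestrict hBG]
      simp only [sub_apply, one_apply_eq_self, map_sub, hPP, hQQ]
      abel)
    (by
      ext x
      simp only [mul_apply_eq_comp, add_apply, Submodule.coe_add, hrestrict hAG, hrestrict hBG]
      simp only [sub_apply, one_apply_eq_self, map_sub, hPP, hQQ]
      abel)
  -- The fixed space of `J`, seen inside `H`; as a kernel it is closed, hence complete.
  let K : Submodule ℂ H :=
    (G.subtypeL ∘L J ∘L G.orthogonalProjectionOnto - ContinuousLinearMap.id ℂ H).ker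
  have hmem {x : H} : x ∈ K ↔ (J (G.orthogonalProjectionOnto x) : H) = x := sub_eq_zero
  have hKG : K ≤ G := fun x hx ↦ by
    rw [← hmem.1 hx]
    exact Submodule.coe_mem _
  have hK : CompleteSpace K := (ContinuousLinearMap.isClosed_ker _).completeSpace_coe
  let i : K →ₗᵢ[ℂ] G := ⟨Submodule.inclusion hKG, fun _ ↦ rfl⟩
  have hproj (x : G) : G.orthogonalProjectionOnto (x : H) = x :=
    Submodule.orthogonalProjectionOnto_mem_subspace_eq_self x
  obtain ⟨a, Y, ha, hpos, hspec, hone, hA, hB⟩ := hJ K i fun x ↦ by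
    constructor
    · intro hx
      exact ⟨⟨x, hmem.2 (by rw [hproj, hx])⟩, rfl⟩
    · rintro ⟨y, rfl⟩
      have hy := hmem.1 y.2
      have : (y : H) = (i y : H) := rfl
      rw [this, hproj] at hy
      exact Subtype.ext hy
  refine ⟨K, hK, a, Y, ha, hpos, hspec, hone, fun x ↦ ?_, fun x ↦ ?_⟩
  · rw [← hrestrict hAG]
    have := hA (Y.symm x)
    rw [Y.apply_symm_apply] at this
    exact congrArg Subtype.val this
  · rw [← hrestrict hBG]
    have := hB (Y.symm x)
    rw [Y.apply_symm_apply] at this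
    exact congrArg Subtype.val this

end Existence

/-! ### Antidiagonal unitaries and anticommutation with a positive operator -/

section BlockUnitary

variable {K : Type*} [NormedAddCommGroup K] [InnerProductSpace ℂ K] [CompleteSpace K]

theorem block_antidiagonal_mem_unitary {v : K →L[ℂ] K} :
    block 0 v v 0 ∈ unitary (WithLp 2 (K × K) →L[ℂ] WithLp 2 (K × K)) ↔
      v ∈ unitary (K →L[ℂ] K) := by
  rw [Unitary.mem_iff, Unitary.mem_iff, adjoint_block, block_mul, block_mul, ← block_one]
  constructor
  · rintro ⟨h₁, h₂⟩
    have h₁' := (block_injective h₁).1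
    have h₂' := (block_injective h₂).1
    simp only [star_zero, mul_zero, zero_add] at h₁' h₂'
    exact ⟨h₁', h₂'⟩
  · rintro ⟨h₁, h₂⟩
    simp [h₁, h₂]

/-- `s` commutes with `a²`, hence with `|a| = a`. Together with anticommutation this gives `2 a s =
0`. -/
theorem eq_zero_of_anticommute_posDef {a s : K →L[ℂ] K} (ha : 0 ≤ a)
    (hinj : ∀ x, a x = 0 → x = 0) (h : s * a = -(a * s)) : s = 0 := by
  have hsa : IsSelfAdjoint a := .of_nonneg ha
  have hc : Commute s (a * a) := by
    rw [Commute, SemiconjBy, ← mul_assoc, h, neg_mul, mul_assoc, h, mul_neg, neg_neg, mul_assoc]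
  have hc' := (commute_abs hsa hc).eq
  rw [CFC.abs_of_nonneg a ha] at hc'
  ext x
  have hx : a (s x) = -a (s x) := DFunLike.congr_fun (hc'.symm.trans h) x
  refine hinj _ ((smul_eq_zero_iff_right (two_ne_zero (α := ℂ))).1 ?_)
  rw [two_smul]
  exact add_eq_zero_iff_eq_neg.2 hx

end BlockUnitary

/-! ### Transport along `Y` between `K ⊕ K` and the generic part -/

variable {H : Type*} [NormedAddCommGroup H] [InnerProductSpace ℂ H] [CompleteSpace H]
variable {P Q : H →L[ℂ] H}
variable {K : Type*} [NormedAddCommGroup K] [InnerProductSpace ℂ K] [CompleteSpace K]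

omit [CompleteSpace H] [CompleteSpace K] in
theorem conjugate_mul (Y : WithLp 2 (K × K) ≃ₗᵢ[ℂ] generic P Q)
    (X X' : WithLp 2 (K × K) →L[ℂ] WithLp 2 (K × K)) :
    conjugate Y (X * X') = conjugate Y X * conjugate Y X' := by
  ext x
  simp [conjugate]

omit [CompleteSpace H] [CompleteSpace K] in
theorem conjugate_one (Y : WithLp 2 (K × K) ≃ₗᵢ[ℂ] generic P Q) : conjugate Y 1 = 1 := by
  ext x
  simp [conjugate]

omit [CompleteSpace H] [CompleteSpace K] in
theorem conjugate_neg (Y : WithLp 2 (K × K) ≃ₗᵢ[ℂ] generic P Q)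
    (X : WithLp 2 (K × K) →L[ℂ] WithLp 2 (K × K)) : conjugate Y (-X) = -conjugate Y X := by
  ext x
  simp [conjugate]

theorem conjugate_star (Y : WithLp 2 (K × K) ≃ₗᵢ[ℂ] generic P Q)
    (X : WithLp 2 (K × K) →L[ℂ] WithLp 2 (K × K)) :
    conjugate Y (star X) = star (conjugate Y X) := by
  rw [ContinuousLinearMap.star_eq_adjoint (conjugate Y X), ContinuousLinearMap.eq_adjoint_iff]
  intro x y
  change ⟪Y (star X (Y.symm x)), y⟫_ℂ = ⟪x, Y (X (Y.symm y))⟫_ℂ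
  rw [ContinuousLinearMap.star_eq_adjoint, Y.inner_map_eq_flip,
    ContinuousLinearMap.adjoint_inner_left, Y.symm.inner_map_eq_flip, Y.symm_symm]

omit [CompleteSpace H] [CompleteSpace K] in
theorem conjugate_injective (Y : WithLp 2 (K × K) ≃ₗᵢ[ℂ] generic P Q) :
    Function.Injective (conjugate Y) := fun X X' h ↦ by
  ext1 z
  have := DFunLike.congr_fun h (Y z)
  simpa [conjugate] using this

omit [CompleteSpace H] [CompleteSpace K] in
theorem conjugate_surjective (Y : WithLp 2 (K × K) ≃ₗᵢ[ℂ] generic P Q) :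
    Function.Surjective (conjugate Y) := fun T ↦
  ⟨Y.symm.toContinuousLinearEquiv.toContinuousLinearMap ∘L T ∘L
    Y.toContinuousLinearEquiv.toContinuousLinearMap, by ext x; simp [conjugate]⟩

theorem conjugate_mem_unitary (Y : WithLp 2 (K × K) ≃ₗᵢ[ℂ] generic P Q)
    {X : WithLp 2 (K × K) →L[ℂ] WithLp 2 (K × K)} :
    conjugate Y X ∈ unitary (generic P Q →L[ℂ] generic P Q) ↔
      X ∈ unitary (WithLp 2 (K × K) →L[ℂ] WithLp 2 (K × K)) := by
  rw [Unitary.mem_iff, Unitary.mem_iff, ← conjugate_star, ← conjugate_mul, ← conjugate_mul,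
    ← conjugate_one Y, (conjugate_injective Y).eq_iff, (conjugate_injective Y).eq_iff]

/-! ### Unitaries compatible with a canonical form -/

namespace IsCanonicalForm

variable {a : K →L[ℂ] K} {Y : WithLp 2 (K × K) ≃ₗᵢ[ℂ] generic P Q}

omit [CompleteSpace H] in
theorem nonneg (h : IsCanonicalForm P Q a Y) : 0 ≤ a :=
  nonneg_of_re_inner_nonneg h.selfAdjoint fun x ↦ by
    rcases eq_or_ne x 0 with rfl | hx
    · simp
    · exact (h.posDef x hx).le

omit [CompleteSpace H] in
theorem injective (h : IsCanonicalForm P Q a Y) (x : K) (hx : a x = 0) : x = 0 := by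
  by_contra hne
  have := h.posDef x hne
  simp [hx] at this

omit [CompleteSpace H] in
-- `1 - a² = (1 - a)(1 + a)` is a product of commuting nonnegative operators.
theorem sq_le_one (h : IsCanonicalForm P Q a Y) : 0 ≤ 1 - a ^ 2 := by
  have h1 : a ≤ 1 :=
    (CFC.le_one_iff (R := ℝ) a h.selfAdjoint).2 fun r hr ↦ (h.spectrum_subset hr).2
  have h2 : (0 : K →L[ℂ] K) ≤ 1 + a := add_nonneg zero_le_one h.nonneg
  have hc : Commute (1 - a) (1 + a) :=
    ((Commute.one_left _).sub_left ((Commute.one_right a).add_right (Commute.refl a)))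
  have := hc.mul_nonneg (sub_nonneg.2 h1) h2
  convert this using 1
  noncomm_ring

omit [CompleteSpace H] in
-- A vector `x` in the kernel has `a² x = x`, so `a` acts as `-1` on `a x - x`. Positivity forces `a
-- x = x`, and `1` is not an eigenvalue.
theorem sqrt_injective (h : IsCanonicalForm P Q a Y) (x : K)
    (hx : CFC.sqrt (1 - a ^ 2 : K →L[ℂ] K) x = 0) : x = 0 := by
  have h1 : (1 - a ^ 2 : K →L[ℂ] K) x = 0 := by
    rw [← CFC.sqrt_mul_sqrt_self (1 - a ^ 2) h.sq_le_one, mul_apply_eq_comp, hx, map_zero]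
  have h2 : a (a x) = x := by
    rw [sub_apply, one_apply_eq_self, pow_two, mul_apply_eq_comp, sub_eq_zero] at h1
    exact h1.symm
  have h3 : a x - x = 0 := by
    by_contra hne
    have hpos := h.posDef _ hne
    have h4 : a (a x - x) = -(a x - x) := by rw [map_sub, h2, neg_sub]
    rw [h4, inner_neg_left, map_neg, Left.neg_pos_iff] at hpos
    exact absurd hpos (not_lt.2 inner_self_nonneg)
  by_contra hne
  exact h.not_eigenvalue_one (Module.End.hasEigenvalue_of_hasEigenvector
    (x := x) ⟨Module.End.mem_eigenspace_iff.2 (by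
      rw [one_smul]
      exact sub_eq_zero.1 h3), hne⟩)

theorem commute_sqrt {v : K →L[ℂ] K} (hv : Commute v a) :
    Commute v (CFC.sqrt (1 - a ^ 2)) := by
  have h1 : Commute v (1 - a ^ 2) := (Commute.one_right v).sub_right (hv.pow_right 2)
  rw [CFC.sqrt]
  exact (h1.symm.cfcₙ_nnreal _).symm

/-- The unitaries on `K ⊕ K` that anticommute with `diag(a, -a)` and commute with the
antidiagonal part of the canonical form. -/
theorem unitary_intertwining_iff (h : IsCanonicalForm P Q a Y)
    (S : WithLp 2 (K × K) →L[ℂ] WithLp 2 (K × K)) :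
    (S ∈ unitary (WithLp 2 (K × K) →L[ℂ] WithLp 2 (K × K)) ∧
      S * block a 0 0 (-a) = -(block a 0 0 (-a) * S) ∧
      S * block 0 (CFC.sqrt (1 - a ^ 2)) (CFC.sqrt (1 - a ^ 2)) 0 =
        block 0 (CFC.sqrt (1 - a ^ 2)) (CFC.sqrt (1 - a ^ 2)) 0 * S) ↔
    ∃ v ∈ unitary (K →L[ℂ] K), Commute v a ∧ S = block 0 v v 0 := by
  constructor
  · rintro ⟨hS, hA, hB⟩
    obtain ⟨s₁₁, s₁₂, s₂₁, s₂₂, rfl⟩ := exists_eq_block S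
    rw [block_mul, block_mul, block_neg] at hA
    rw [block_mul, block_mul] at hB
    obtain ⟨h₁₁, h₁₂, h₂₁, h₂₂⟩ := block_injective hA
    obtain ⟨-, -, -, k₂₂⟩ := block_injective hB
    simp only [mul_zero, zero_mul, add_zero, zero_add, mul_neg, neg_mul, neg_neg, neg_inj]
      at h₁₁ h₁₂ h₂₁ h₂₂ k₂₂
    have e₁₁ : s₁₁ = 0 := eq_zero_of_anticommute_posDef h.nonneg h.injective h₁₁
    have e₂₂ : s₂₂ = 0 :=
      eq_zero_of_anticommute_posDef h.nonneg h.injective (by rw [← h₂₂, neg_neg])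
    have hc : Commute s₁₂ a := h₁₂
    -- With `c = √(1 - a²)`, the lower right entry of the commutation relation reads `s₂₁ c = c
    -- s₁₂`. The right side is `s₁₂ c`, and `c` cancels.
    have hv : s₂₁ = s₁₂ := by
      refine mul_right_cancel_of_injective (.of_nonneg (CFC.sqrt_nonneg (1 - a ^ 2)))
        h.sqrt_injective ?_
      rw [k₂₂, (commute_sqrt hc).eq]
    subst e₁₁ e₂₂ hv
    exact ⟨_, block_antidiagonal_mem_unitary.1 hS, hc, rfl⟩
  · rintro ⟨v, hv, hc, rfl⟩
    refine ⟨block_antidiagonal_mem_unitary.2 hv, ?_, ?_⟩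
    · simp [block_mul, block_neg, hc.eq]
    · simp [block_mul, (commute_sqrt hc).eq]

end IsCanonicalForm

/-! ### Unitaries of `H` exchanging the two projections -/

theorem exists_restrict_unitary {U : H →L[ℂ] H} (hU : U ∈ unitary (H →L[ℂ] H))
    {M N : Submodule ℂ H} (h : ∀ x ∈ M, U x ∈ N) (h' : ∀ x ∈ N, star U x ∈ M) :
    ∃ e : M ≃ₗᵢ[ℂ] N, ∀ x, (e x : H) = U x := by
  let f : M →ₗᵢ[ℂ] N :=
    ⟨U.toLinearMap.restrict h, fun x ↦ ContinuousLinearMap.norm_map_of_mem_unitary hU x⟩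
  refine ⟨LinearIsometryEquiv.ofSurjective f fun y ↦ ⟨⟨star U y, h' y y.2⟩, Subtype.ext ?_⟩,
    fun _ ↦ rfl⟩
  exact DFunLike.congr_fun (Unitary.mem_iff.1 hU).2 (y : H)

theorem intertwining_iff (U : H →L[ℂ] H) :
    (U ∈ unitary (H →L[ℂ] H) ∧ Q = U * P * star U ∧ P = U * Q * star U) ↔
      U ∈ unitary (H →L[ℂ] H) ∧ U * P = Q * U ∧ U * Q = P * U := by
  refine and_congr_right fun hU ↦ ?_
  obtain ⟨h₁, h₂⟩ := Unitary.mem_iff.1 hU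
  have key (S T : H →L[ℂ] H) : T = U * S * star U ↔ U * S = T * U := by
    constructor
    · intro h
      rw [h, mul_assoc, h₁, mul_one]
    · intro h
      rw [h, mul_assoc, h₂, mul_one]
  rw [key, key]

/-- A unitary that intertwines the two projections exchanges the four special subspaces. -/
theorem maps_parts (hP : IsStarProjection P) (hQ : IsStarProjection Q) {U : H →L[ℂ] H}
    (hUP : U * P = Q * U) (hUQ : U * Q = P * U) :
    (∀ x ∈ M00 P Q, U x ∈ M00 P Q) ∧ (∀ x ∈ M01 P Q, U x ∈ M10 P Q) ∧
      (∀ x ∈ M10 P Q, U x ∈ M01 P Q) ∧ ∀ x ∈ M11 P Q, U x ∈ M11 P Q := by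
  have hUP' (x : H) : Q (U x) = U (P x) := (DFunLike.congr_fun hUP x).symm
  have hUQ' (x : H) : P (U x) = U (Q x) := (DFunLike.congr_fun hUQ x).symm
  refine ⟨fun x hx ↦ ?_, fun x hx ↦ ?_, fun x hx ↦ ?_, fun x hx ↦ ?_⟩
  · rw [mem_M00 hP hQ] at hx ⊢
    rw [hUP', hUQ', hx.1, hx.2]
    exact ⟨rfl, rfl⟩
  · rw [mem_M01 hP] at hx
    rw [mem_M10 hQ, hUP', hUQ', hx.1, hx.2, map_zero]
    exact ⟨rfl, rfl⟩
  · rw [mem_M10 hQ] at hx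
    rw [mem_M01 hP, hUP', hUQ', hx.1, hx.2, map_zero]
    exact ⟨rfl, rfl⟩
  · rw [mem_M11] at hx ⊢
    rw [hUP', hUQ', hx.1, hx.2, map_zero]
    exact ⟨rfl, rfl⟩

/-- Makes every mapping property of `U` available for its adjoint, which yields surjectivity of the
restrictions and invariance of the generic part. -/
theorem intertwining_star (hP : IsStarProjection P) (hQ : IsStarProjection Q) {U : H →L[ℂ] H}
    (hUP : U * P = Q * U) (hUQ : U * Q = P * U) :
    star U * P = Q * star U ∧ star U * Q = P * star U := by
  have h₁ := congrArg star hUP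
  have h₂ := congrArg star hUQ
  rw [star_mul, star_mul, hP.isSelfAdjoint.star_eq, hQ.isSelfAdjoint.star_eq] at h₁ h₂
  exact ⟨h₂.symm, h₁.symm⟩

theorem map_generic_of_intertwining (hP : IsStarProjection P) (hQ : IsStarProjection Q)
    {U : H →L[ℂ] H} (hUP : U * P = Q * U) (hUQ : U * Q = P * U) :
    ∀ x ∈ generic P Q, U x ∈ generic P Q := by
  obtain ⟨h₁, h₂⟩ := intertwining_star hP hQ hUP hUQ
  obtain ⟨m₀, m₁, m₂, m₃⟩ := maps_parts hP hQ h₁ h₂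
  exact fun x hx ↦ map_mem_generic (fun y hy ↦ M00_le_sup (m₀ y hy))
    (fun y hy ↦ M10_le_sup (m₁ y hy)) (fun y hy ↦ M01_le_sup (m₂ y hy))
    (fun y hy ↦ M11_le_sup (m₃ y hy)) hx

omit [CompleteSpace H] in
/-- On the generic part, intertwining `P` and `Q` in both directions amounts to anticommuting with
`P - Q` and commuting with `1 - P - Q`. -/
theorem intertwining_on_generic_iff {A B T : generic P Q →L[ℂ] generic P Q}
    (hA : ∀ x : generic P Q, (P - Q) (x : H) = A x)
    (hB : ∀ x : generic P Q, (1 - P - Q) (x : H) = B x) {U : H →L[ℂ] H}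
    (hU : ∀ x : generic P Q, U x = T x) :
    ((∀ x : generic P Q, U (P x) = Q (U x)) ∧ ∀ x : generic P Q, U (Q x) = P (U x)) ↔
      T * A = -(A * T) ∧ T * B = B * T := by
  have e₁ : T * A = -(A * T) ↔
      ∀ x : generic P Q, U (P x) - U (Q x) = -(P (U x) - Q (U x)) := by
    rw [ContinuousLinearMap.ext_iff]
    refine forall_congr' fun x ↦ ?_
    rw [Subtype.ext_iff]
    simp only [mul_apply_eq_comp, neg_apply, Submodule.coe_neg, ← hU, ← hA, sub_apply, map_sub]
  have e₂ : T * B = B * T ↔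
      ∀ x : generic P Q, U x - U (P x) - U (Q x) = U x - P (U x) - Q (U x) := by
    rw [ContinuousLinearMap.ext_iff]
    refine forall_congr' fun x ↦ ?_
    rw [Subtype.ext_iff]
    simp only [mul_apply_eq_comp, ← hU, ← hB, sub_apply, map_sub, one_apply_eq_self]
  rw [e₁, e₂]
  constructor
  · rintro ⟨h₁, h₂⟩
    refine ⟨fun x ↦ ?_, fun x ↦ ?_⟩ <;> rw [h₁, h₂] <;> abel
  · rintro ⟨h₁, h₂⟩
    refine ⟨fun x ↦ ?_, fun x ↦ ?_⟩
    -- `h₁` concerns `UP - UQ` and `h₂` concerns `-(UP + UQ)`, whence the signs in the half-sum and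
    -- half-difference.
    · linear_combination (norm := module) (2⁻¹ : ℂ) • h₁ x - (2⁻¹ : ℂ) • h₂ x
    · linear_combination (norm := module) -(2⁻¹ : ℂ) • h₁ x - (2⁻¹ : ℂ) • h₂ x

end TwoProjections

open TwoProjections in
theorem theorem1 {H : Type*} [NormedAddCommGroup H] [InnerProductSpace ℂ H] [CompleteSpace H]
    (P Q : H →L[ℂ] H) (hP : IsStarProjection P) (hQ : IsStarProjection Q)
    (hdim : hilbertDim (M01 P Q) = hilbertDim (M10 P Q)) :
    (∃ (K : Submodule ℂ H) (_ : CompleteSpace K) (a : K →L[ℂ] K)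
        (Y : WithLp 2 (K × K) ≃ₗᵢ[ℂ] generic P Q), IsCanonicalForm P Q a Y) ∧
    ∀ (K : Type*) [NormedAddCommGroup K] [InnerProductSpace ℂ K] [CompleteSpace K]
      (a : K →L[ℂ] K) (Y : WithLp 2 (K × K) ≃ₗᵢ[ℂ] generic P Q), IsCanonicalForm P Q a Y →
      ∀ U : H →L[ℂ] H,
        (U ∈ unitary (H →L[ℂ] H) ∧ Q = U * P * star U ∧ P = U * Q * star U) ↔
        ∃ (U₀ : M00 P Q ≃ₗᵢ[ℂ] M00 P Q) (U₁₀ : M01 P Q ≃ₗᵢ[ℂ] M10 P Q)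
          (U₀₁ : M10 P Q ≃ₗᵢ[ℂ] M01 P Q) (U₁ : M11 P Q ≃ₗᵢ[ℂ] M11 P Q) (v : K →L[ℂ] K),
          v ∈ unitary (K →L[ℂ] K) ∧ Commute v a ∧
          U = directSum hP hQ (U₀ : M00 P Q →L[ℂ] M00 P Q) (U₁₀ : M01 P Q →L[ℂ] M10 P Q)
            (U₀₁ : M10 P Q →L[ℂ] M01 P Q) (U₁ : M11 P Q →L[ℂ] M11 P Q)
            (conjugate Y (block 0 v v 0)) := by
  refine ⟨exists_isCanonicalForm hP hQ, fun K _ _ _ a Y hY U ↦ ?_⟩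
  rw [intertwining_iff]
  constructor
  · rintro ⟨hU, hUP, hUQ⟩
    obtain ⟨hUP', hUQ'⟩ := intertwining_star hP hQ hUP hUQ
    obtain ⟨m₀₀, m₀₁, m₁₀, m₁₁⟩ := maps_parts hP hQ hUP hUQ
    obtain ⟨n₀₀, n₀₁, n₁₀, n₁₁⟩ := maps_parts hP hQ hUP' hUQ'
    obtain ⟨U₀, hU₀⟩ := exists_restrict_unitary hU m₀₀ n₀₀
    obtain ⟨U₁₀, hU₁₀⟩ := exists_restrict_unitary hU m₀₁ n₁₀
    obtain ⟨U₀₁, hU₀₁⟩ := exists_restrict_unitary hU m₁₀ n₀₁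
    obtain ⟨U₁, hU₁⟩ := exists_restrict_unitary hU m₁₁ n₁₁
    obtain ⟨e, he⟩ := exists_restrict_unitary hU (map_generic_of_intertwining hP hQ hUP hUQ)
      (map_generic_of_intertwining hP hQ hUP' hUQ')
    -- Pull the restriction to the generic part back to `K ⊕ K`, where the block computation
    -- applies.
    obtain ⟨S, hS⟩ := conjugate_surjective Y (e : generic P Q →L[ℂ] generic P Q)
    have heu : (e : generic P Q →L[ℂ] generic P Q) ∈
        unitary (generic P Q →L[ℂ] generic P Q) := by
      rw [Unitary.mem_iff, LinearIsometryEquiv.star_eq_symm]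
      constructor <;> ext x <;> simp
    obtain ⟨hA, hB⟩ := (intertwining_on_generic_iff hY.eq_A hY.eq_B
      (T := (e : generic P Q →L[ℂ] generic P Q)) (fun x ↦ (he x).symm)).1
      ⟨fun x ↦ DFunLike.congr_fun hUP (x : H), fun x ↦ DFunLike.congr_fun hUQ (x : H)⟩
    rw [← hS, ← conjugate_mul, ← conjugate_mul] at hA hB
    rw [← conjugate_neg] at hA
    rw [← hS, conjugate_mem_unitary] at heu
    obtain ⟨v, hv, hc, rfl⟩ := (hY.unitary_intertwining_iff S).1
      ⟨heu, conjugate_injective Y hA, conjugate_injective Y hB⟩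
    refine ⟨U₀, U₁₀, U₀₁, U₁, v, hv, hc, ?_⟩
    rw [hS]
    refine eq_of_eqOn_parts hP hQ ?_ ?_ ?_ ?_ ?_ <;> intro x
    · rw [directSum_apply_M00]; exact (hU₀ x).symm
    · rw [directSum_apply_M01]; exact (hU₁₀ x).symm
    · rw [directSum_apply_M10]; exact (hU₀₁ x).symm
    · rw [directSum_apply_M11]; exact (hU₁ x).symm
    · rw [directSum_apply_generic]; exact (he x).symm
  · rintro ⟨U₀, U₁₀, U₀₁, U₁, v, hv, hc, rfl⟩
    obtain ⟨hS, hA, hB⟩ := (hY.unitary_intertwining_iff _).2 ⟨v, hv, hc, rfl⟩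
    refine ⟨directSum_mem_unitary hP hQ U₀ U₁₀ U₀₁ U₁ ((conjugate_mem_unitary Y).2 hS), ?_⟩
    obtain ⟨hGP, hGQ⟩ := (intertwining_on_generic_iff hY.eq_A hY.eq_B
      (directSum_apply_generic hP hQ (U₀ : M00 P Q →L[ℂ] M00 P Q) (U₁₀ : M01 P Q →L[ℂ] M10 P Q)
            (U₀₁ : M10 P Q →L[ℂ] M01 P Q) (U₁ : M11 P Q →L[ℂ] M11 P Q)
            (conjugate Y (block 0 v v 0)))).2
      ⟨by rw [← conjugate_mul, hA, conjugate_neg, conjugate_mul],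
        by rw [← conjugate_mul, hB, conjugate_mul]⟩
    have h₀₀ (x : M00 P Q) := (mem_M00 hP hQ).1 x.2
    have h₀₁ (x : M01 P Q) := (mem_M01 hP).1 x.2
    have h₁₀ (x : M10 P Q) := (mem_M10 hQ).1 x.2
    have h₁₁ (x : M11 P Q) := mem_M11.1 x.2
    -- On the special subspaces `P` and `Q` act as `0` or `1`, so both relations follow from where
    -- the pieces land; the generic part is `hGP` and `hGQ`.
    constructor <;> refine eq_of_eqOn_parts hP hQ ?_ ?_ ?_ ?_ ?_ <;> intro x <;>
      rw [mul_apply_eq_comp, mul_apply_eq_comp]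
    · rw [(h₀₀ x).1, directSum_apply_M00]; exact (h₀₀ (U₀ x)).2.symm
    · rw [(h₀₁ x).1, directSum_apply_M01]; exact (h₁₀ (U₁₀ x)).1.symm
    · rw [(h₁₀ x).2, directSum_apply_M10, map_zero]; exact (h₀₁ (U₀₁ x)).2.symm
    · rw [(h₁₁ x).1, directSum_apply_M11, map_zero]; exact (h₁₁ (U₁ x)).2.symm
    · exact hGP x
    · rw [(h₀₀ x).2, directSum_apply_M00]; exact (h₀₀ (U₀ x)).1.symm
    · rw [(h₀₁ x).2, directSum_apply_M01, map_zero]; exact (h₁₀ (U₁₀ x)).2.symm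
    · rw [(h₁₀ x).1, directSum_apply_M10]; exact (h₀₁ (U₀₁ x)).1.symm
    · rw [(h₁₁ x).2, directSum_apply_M11, map_zero]; exact (h₁₁ (U₁ x)).1.symm
    · exact hGQ x
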